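/- Let $K$ be a field and let $L$ be a Lie algebra over $K$. Write $L^2=[L,L]$ for the derived subalgebra and $Z(L)$ for the center. Suppose that $L$ is a $d$-generator generalized Heisenberg Lie algebra, that is, $L^2=Z(L)$ and $d$ is the least number of elements that generate $L$ as a Lie algebra. Let $\mathcal M(L)$ denote the Schur multiplier of $L$: for a free Lie algebra $F$ over $K$ and a surjective homomorphism $F\to L$ with kernel $R$, $\mathcal M(L)=(R\cap F^2)/[R,F]$. Then, for every such free presentation, $L$ and $\mathcal M(L)$ are finite-dimensional, and (i) $\dim L^2=\frac12 d(d-1)-1$ if and only if $\dim\mathcal M(L)=\frac13 d(d-1)(d+1)-d+1$; (ii) $\dim L^2=\frac12 d(d-1)-2$ if and only if $\dim\mathcal M(L)=\frac13 d(d-1)(d+1)-2d+2$. -/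

import Mathlib

/-- `L` is generated as a Lie algebra over `K` by `d` elements and by no fewer. -/
def IsMinimallyGeneratedBy (K L : Type*) [Field K] [LieRing L] [LieAlgebra K L] (d : ℕ) : Prop :=
  IsLeast {n : ℕ | ∃ s : Finset L, s.card = n ∧ LieSubalgebra.lieSpan K L (s : Set L) = ⊤} d

/-- The derived subalgebra `L² = [L, L]`, as an ideal of `L`. -/
abbrev derivedIdeal (K L : Type*) [Field K] [LieRing L] [LieAlgebra K L] : LieIdeal K L :=
  ⁅(⊤ : LieIdeal K L), (⊤ : LieIdeal K L)⁆

/-- A generalized Heisenberg Lie algebra: one with `L² = Z(L)`. -/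
def IsGeneralizedHeisenberg (K L : Type*) [Field K] [LieRing L] [LieAlgebra K L] : Prop :=
  derivedIdeal K L = LieAlgebra.center K L

/-- For a free presentation `π : F → L` with `F` free and kernel `R`, the Schur multiplier
`(R ∩ F²) / [R, F]` of `L`, as a vector space over `K`. -/
abbrev SchurMultiplier {K L X : Type*} [Field K] [LieRing L] [LieAlgebra K L]
    (π : FreeLieAlgebra K X →ₗ⁅K⁆ L) : Type _ :=
  (π.ker ⊓ derivedIdeal K (FreeLieAlgebra K X)).toSubmodule ⧸
    (⁅π.ker, (⊤ : LieIdeal K (FreeLieAlgebra K X))⁆).toSubmodule.submoduleOf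
      (π.ker ⊓ derivedIdeal K (FreeLieAlgebra K X)).toSubmodule

/-! Put $V=L/L^2$, of dimension $d$, let $c=\dim L^2$, and let $\beta:\bigwedge^2V\to L^2$ be the
surjective commutator map. The multiplier is computed from an explicit central extension: the graded
algebra `Cover β` $=V\oplus\bigwedge^2V\oplus(L^2\otimes V)/J$, where $J$ is spanned by the cyclic
sums that the Jacobi identity forces to vanish. Its projection to $L$ has central kernel inside its
derived ideal, and it maps over $L$ to every central extension, in particular to $F/[R,F]$; hence
the kernel is $\mathcal M(L)$ (`SchurMultiplier.nonempty_equiv_ker_proj`).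

With $k=\binom d2-c$ and $n$ the dimension of the kernel of $\bigwedge^3V\to L^2\otimes V$, counting
dimensions gives $\dim\mathcal M(L)=\frac13d(d-1)(d+1)-k(d-1)+n$. The claims are that the values for
$k=1$ and $k=2$, with $n=0$, occur for no other $k$.

So $n$ must be bounded. Order the pairs of basis vectors colexicographically and call a pair
dependent if its $\beta$-value lies in the span of the earlier values; there are at most $k$ such
pairs. A leading-term argument bounds $n$ by the number of triangles in the graph of dependent pairs
(`finrank_ker_cyclicMap_le`). Thus $n=0$ for $k\le2$, and $3n\le k(d-2)$ always, which for $k\ge3$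
leaves the multiplier too small for either formula. -/

open TensorProduct

/-! ### Exterior squares and the cyclic sum -/

section Alternating

variable {K V M : Type*} [Field K] [AddCommGroup V] [Module K V] [AddCommGroup M] [Module K M]

/-- The product `x ∧ y` in the exterior square. -/
abbrev wedge (K : Type*) {V : Type*} [Field K] [AddCommGroup V] [Module K V] (x y : V) :
    ⋀[K]^2 V :=
  exteriorPower.ιMulti K 2 ![x, y]

/-- The alternating map in two variables given by an alternating bilinear map. -/
def alternatingMapOfBilin (B : V →ₗ[K] V →ₗ[K] M) (h : ∀ x, B x x = 0) :
    V [⋀^Fin 2]→ₗ[K] M where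
  toFun v := B (v 0) (v 1)
  map_update_add' v i x y := by fin_cases i <;> simp
  map_update_smul' v i c x := by fin_cases i <;> simp
  map_eq_zero_of_eq' v i j hv hij := by
    fin_cases i <;> fin_cases j <;> simp_all

/-- The linear map on the exterior square given by an alternating bilinear map. -/
noncomputable def wedgeLift (B : V →ₗ[K] V →ₗ[K] M) (h : ∀ x, B x x = 0) : ⋀[K]^2 V →ₗ[K] M :=
  exteriorPower.alternatingMapLinearEquiv (alternatingMapOfBilin B h)

@[simp]
lemma wedgeLift_wedge (B : V →ₗ[K] V →ₗ[K] M) (h : ∀ x, B x x = 0) (x y : V) :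
    wedgeLift B h (wedge K x y) = B x y := by
  simp [wedgeLift, wedge, exteriorPower.alternatingMapLinearEquiv_apply_ιMulti,
    alternatingMapOfBilin]

/-- The wedge product as a bilinear map. -/
noncomputable def wedgeBilin (K V : Type*) [Field K] [AddCommGroup V] [Module K V] :
    V →ₗ[K] V →ₗ[K] ⋀[K]^2 V :=
  have h₀ (x y z : V) : Function.update ![x, y] 0 z = ![z, y] := by ext i; fin_cases i <;> rfl
  have h₁ (x y z : V) : Function.update ![x, y] 1 z = ![x, z] := by ext i; fin_cases i <;> rfl
  LinearMap.mk₂ K (wedge K)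
    (fun x x' y => by
      have h := (exteriorPower.ιMulti K 2).map_update_add ![x, y] 0 x x'
      rwa [h₀, h₀, h₀] at h)
    (fun c x y => by
      have h := (exteriorPower.ιMulti K 2).map_update_smul ![x, y] 0 c x
      rwa [h₀, h₀] at h)
    (fun x y y' => by
      have h := (exteriorPower.ιMulti K 2).map_update_add ![x, y] 1 y y'
      rwa [h₁, h₁, h₁] at h)
    (fun c x y => by
      have h := (exteriorPower.ιMulti K 2).map_update_smul ![x, y] 1 c y
      rwa [h₁, h₁] at h)

lemma wedgeBilin_apply (x y : V) : wedgeBilin K V x y = wedge K x y := rfl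

lemma wedge_self (x : V) : wedge K x x = 0 :=
  (exteriorPower.ιMulti K 2).map_eq_zero_of_eq ![x, x] (i := 0) (j := 1) rfl (by decide)

lemma wedge_swap (x y : V) : wedge K y x = -wedge K x y := by
  have h := wedge_self (K := K) (x + y)
  simp only [← wedgeBilin_apply, map_add, LinearMap.add_apply] at h
  simp only [wedgeBilin_apply, wedge_self] at h
  rw [eq_neg_iff_add_eq_zero]
  simpa using h

lemma wedge_induction {p : ⋀[K]^2 V → Prop} (h0 : p 0) (hadd : ∀ a b, p a → p b → p (a + b))
    (hsmul : ∀ (c : K) a, p a → p (c • a)) (h : ∀ x y, p (wedge K x y)) (a : ⋀[K]^2 V) : p a := by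
  have ha : a ∈ Submodule.span K (Set.range (exteriorPower.ιMulti K 2 (M := V))) := by
    rw [exteriorPower.ιMulti_span]; trivial
  induction ha using Submodule.span_induction with
  | mem x hx =>
    obtain ⟨v, rfl⟩ := hx
    have : v = ![v 0, v 1] := by ext i; fin_cases i <;> rfl
    rw [this]; exact h _ _
  | zero => exact h0
  | add x y _ _ hx hy => exact hadd _ _ hx hy
  | smul c x _ hx => exact hsmul _ _ hx

variable {Z : Type*} [AddCommGroup Z] [Module K Z]

/-- The cyclic sum `β(x ∧ y) ⊗ z + β(y ∧ z) ⊗ x + β(z ∧ x) ⊗ y` as an alternating map. -/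
noncomputable def cyclicSum (β : ⋀[K]^2 V →ₗ[K] Z) : V [⋀^Fin 3]→ₗ[K] Z ⊗[K] V where
  toFun v := β (wedgeBilin K V (v 0) (v 1)) ⊗ₜ v 2 + β (wedgeBilin K V (v 1) (v 2)) ⊗ₜ v 0 +
    β (wedgeBilin K V (v 2) (v 0)) ⊗ₜ v 1
  map_update_add' v i x y := by
    have h₀ : (2 : Fin 3) ≠ 0 := Fin.ne_of_val_ne (by decide)
    have h₁ : (2 : Fin 3) ≠ 1 := Fin.ne_of_val_ne (by decide)
    fin_cases i <;> simp [-Fin.reduceEq, h₀, h₀.symm, h₁, h₁.symm, TensorProduct.add_tmul,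
      TensorProduct.tmul_add] <;> abel
  map_update_smul' v i c x := by
    have h₀ : (2 : Fin 3) ≠ 0 := Fin.ne_of_val_ne (by decide)
    have h₁ : (2 : Fin 3) ≠ 1 := Fin.ne_of_val_ne (by decide)
    fin_cases i <;> simp [-Fin.reduceEq, h₀, h₀.symm, h₁, h₁.symm, ← TensorProduct.smul_tmul']
  map_eq_zero_of_eq' v i j hv hij := by
    have h : ∀ x y : V, wedgeBilin K V y x = -wedgeBilin K V x y := wedge_swap
    have h' : ∀ x : V, wedgeBilin K V x x = 0 := wedge_self
    fin_cases i <;> fin_cases j <;>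
      first
      | exact absurd rfl hij
      | (simp only [Fin.zero_eta, Fin.mk_one, Fin.reduceFinMk] at hv
         simp [hv, h', h (v 0) (v 1), h (v 0) (v 2), h (v 1) (v 2), TensorProduct.neg_tmul])

/-- The linear map `⋀³V → Z ⊗ V` given by the cyclic sum. -/
noncomputable def cyclicMap (β : ⋀[K]^2 V →ₗ[K] Z) : ⋀[K]^3 V →ₗ[K] Z ⊗[K] V :=
  exteriorPower.alternatingMapLinearEquiv (cyclicSum β)

lemma cyclicMap_ιMulti (β : ⋀[K]^2 V →ₗ[K] Z) (v : Fin 3 → V) :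
    cyclicMap β (exteriorPower.ιMulti K 3 v) =
      β (wedge K (v 0) (v 1)) ⊗ₜ v 2 + β (wedge K (v 1) (v 2)) ⊗ₜ v 0 +
        β (wedge K (v 2) (v 0)) ⊗ₜ v 1 :=
  exteriorPower.alternatingMapLinearEquiv_apply_ιMulti _ _

end Alternating

/-! ### The covering Lie algebra -/

section Cover

variable {K V Z : Type*} [Field K] [AddCommGroup V] [Module K V] [AddCommGroup Z] [Module K Z]

/-- The quotient of `Z ⊗ V` by the cyclic sums. -/
abbrev CyclicQuotient (β : ⋀[K]^2 V →ₗ[K] Z) : Type _ := (Z ⊗[K] V) ⧸ (cyclicMap β).range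

/-- The Lie algebra `V ⊕ ⋀²V ⊕ (Z ⊗ V) / J` attached to `β : ⋀²V → Z`, which covers the Lie algebra
of class two with commutator map `β`. -/
def Cover (β : ⋀[K]^2 V →ₗ[K] Z) : Type _ := V × ⋀[K]^2 V × CyclicQuotient β

namespace Cover

variable (β : ⋀[K]^2 V →ₗ[K] Z)

noncomputable instance : AddCommGroup (Cover β) :=
  inferInstanceAs (AddCommGroup (V × ⋀[K]^2 V × CyclicQuotient β))

noncomputable instance : Module K (Cover β) :=
  inferInstanceAs (Module K (V × ⋀[K]^2 V × CyclicQuotient β))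

/-- The component of degree one. -/
noncomputable def deg₁ : Cover β →ₗ[K] V := LinearMap.fst K V (⋀[K]^2 V × CyclicQuotient β)

/-- The component of degree two. -/
noncomputable def deg₂ : Cover β →ₗ[K] ⋀[K]^2 V :=
  LinearMap.fst K (⋀[K]^2 V) (CyclicQuotient β) ∘ₗ LinearMap.snd K V _

/-- The component of degree three. -/
noncomputable def deg₃ : Cover β →ₗ[K] CyclicQuotient β :=
  LinearMap.snd K (⋀[K]^2 V) (CyclicQuotient β) ∘ₗ LinearMap.snd K V _

variable {β}

/-- The element with given components. -/
noncomputable def mk (v : V) (a : ⋀[K]^2 V) (w : CyclicQuotient β) : Cover β := (v, a, w)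

@[simp] lemma deg₁_mk (v : V) (a : ⋀[K]^2 V) (w : CyclicQuotient β) : deg₁ β (mk v a w) = v := rfl
@[simp] lemma deg₂_mk (v : V) (a : ⋀[K]^2 V) (w : CyclicQuotient β) : deg₂ β (mk v a w) = a := rfl
@[simp] lemma deg₃_mk (v : V) (a : ⋀[K]^2 V) (w : CyclicQuotient β) : deg₃ β (mk v a w) = w := rfl

@[ext]
lemma ext {g h : Cover β} (h₁ : deg₁ β g = deg₁ β h) (h₂ : deg₂ β g = deg₂ β h)
    (h₃ : deg₃ β g = deg₃ β h) : g = h :=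
  Prod.ext h₁ (Prod.ext h₂ h₃)

/-- The class of `z ⊗ v`. -/
noncomputable def cls (β : ⋀[K]^2 V →ₗ[K] Z) : Z →ₗ[K] V →ₗ[K] CyclicQuotient β :=
  (TensorProduct.mk K Z V).compr₂ (cyclicMap β).range.mkQ

lemma cls_cyclic (x y z : V) : cls β (β (wedgeBilin K V x y)) z + cls β (β (wedgeBilin K V y z)) x +
    cls β (β (wedgeBilin K V z x)) y = 0 := by
  simp only [cls, LinearMap.compr₂_apply, TensorProduct.mk_apply, ← map_add]
  rw [Submodule.mkQ_apply, Submodule.Quotient.mk_eq_zero]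
  exact ⟨_, cyclicMap_ιMulti β ![x, y, z]⟩

/-- Degree two acts only through `β`, so the kernel of `β` and the degree three part are central. -/
noncomputable instance : Bracket (Cover β) (Cover β) where
  bracket g h := mk 0 (wedgeBilin K V (deg₁ β g) (deg₁ β h))
    (cls β (β (deg₂ β g)) (deg₁ β h) - cls β (β (deg₂ β h)) (deg₁ β g))

lemma lie_def (g h : Cover β) : ⁅g, h⁆ = mk 0 (wedgeBilin K V (deg₁ β g) (deg₁ β h))
    (cls β (β (deg₂ β g)) (deg₁ β h) - cls β (β (deg₂ β h)) (deg₁ β g)) := rfl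

noncomputable instance : LieRing (Cover β) where
  add_lie g h k := by ext <;> (simp [lie_def]; try abel)
  lie_add g h k := by ext <;> (simp [lie_def]; try abel)
  lie_self g := by
    ext <;> simp [lie_def]
    rw [wedgeBilin_apply, wedge_self]
  leibniz_lie g h k := by
    ext
    · simp [lie_def]
    · simp [lie_def]
    · simp only [lie_def, deg₁_mk, deg₂_mk, deg₃_mk, map_add, map_zero, LinearMap.zero_apply]
      -- In degree three the Jacobi identity is exactly the relation imposed by the quotient.
      have h1 := cls_cyclic (β := β) (deg₁ β g) (deg₁ β h) (deg₁ β k)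
      have h2 : wedgeBilin K V (deg₁ β k) (deg₁ β g) = -wedgeBilin K V (deg₁ β g) (deg₁ β k) :=
        wedge_swap _ _
      rw [h2] at h1
      simp only [map_neg, LinearMap.neg_apply] at h1
      rw [zero_sub, sub_zero, zero_sub, neg_eq_iff_add_eq_zero, ← h1]
      abel

noncomputable instance : LieAlgebra K (Cover β) where
  lie_smul c g h := by ext <;> simp [lie_def, smul_sub]

end Cover

end Cover

/-! ### Central extensions and derived ideals -/

section CentralExtension

variable {K A B : Type*} [Field K] [LieRing A] [LieAlgebra K A] [LieRing B] [LieAlgebra K B]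

lemma lie_mem_derivedIdeal (x y : A) : ⁅x, y⁆ ∈ derivedIdeal K A :=
  LieSubmodule.lie_mem_lie (LieSubmodule.mem_top x) (LieSubmodule.mem_top y)

lemma derivedIdeal_le {S : Submodule K A} (h : ∀ x y : A, ⁅x, y⁆ ∈ S) {x : A}
    (hx : x ∈ derivedIdeal K A) : x ∈ S := by
  have hx' : x ∈ (derivedIdeal K A).toSubmodule := hx
  rw [derivedIdeal, LieSubmodule.lieIdeal_oper_eq_linear_span'] at hx'
  refine Submodule.span_le.mpr ?_ hx'
  rintro _ ⟨y, -, z, -, rfl⟩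
  exact h y z

/-- Two homomorphisms which differ by central elements agree on the derived ideal. -/
lemma LieHom.eq_on_derivedIdeal {f g : A →ₗ⁅K⁆ B} (h : ∀ x (b : B), ⁅f x - g x, b⁆ = 0) {x : A}
    (hx : x ∈ derivedIdeal K A) : f x = g x := by
  refine derivedIdeal_le (S := LinearMap.eqLocus (f : A →ₗ[K] B) (g : A →ₗ[K] B)) ?_ hx
  intro x y
  have hx (b : B) : ⁅f x, b⁆ = ⁅g x, b⁆ := by simpa [sub_lie, sub_eq_zero] using h x b
  have hy (b : B) : ⁅b, f y⁆ = ⁅b, g y⁆ := by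
    rw [← lie_skew, ← lie_skew b (g y), neg_inj]
    simpa [sub_lie, sub_eq_zero] using h y b
  simp [LinearMap.mem_eqLocus, hx, hy]

variable {L : Type*} [LieRing L] [LieAlgebra K L]

/-- If `τ : B → L` is a central extension then the derived ideal of `B` is the image of the derived
ideal of any `A` which maps to `B` and onto `L`. -/
lemma exists_mem_derivedIdeal_of_central {π : A →ₗ⁅K⁆ L} (hπ : Function.Surjective π)
    {τ : B →ₗ⁅K⁆ L} (hτ : ∀ g, τ g = 0 → ∀ h : B, ⁅g, h⁆ = 0) {φ : A →ₗ⁅K⁆ B}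
    (hφ : ∀ x, τ (φ x) = π x) {g : B} (hg : g ∈ derivedIdeal K B) :
    ∃ x ∈ derivedIdeal K A, φ x = g := by
  suffices h : g ∈ (derivedIdeal K A).toSubmodule.map (φ : A →ₗ[K] B) by simpa using h
  refine derivedIdeal_le (fun g h => ?_) hg
  obtain ⟨x, hx⟩ := hπ (τ g)
  obtain ⟨y, hy⟩ := hπ (τ h)
  refine ⟨⁅x, y⁆, lie_mem_derivedIdeal x y, ?_⟩
  have h1 (b : B) : ⁅φ x, b⁆ = ⁅g, b⁆ := by
    rw [← sub_eq_zero, ← sub_lie]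
    exact hτ _ (by simp [hφ, hx]) b
  have h2 (b : B) : ⁅b, φ y⁆ = ⁅b, h⁆ := by
    rw [← lie_skew, ← lie_skew b h, neg_inj, ← sub_eq_zero, ← sub_lie]
    exact hτ _ (by simp [hφ, hy]) b
  simp [h1, h2]

end CentralExtension

/-! ### The multiplier as the kernel of a covering extension -/

section Hopf

variable {K L X G : Type*} [Field K] [LieRing L] [LieAlgebra K L] [LieRing G] [LieAlgebra K G]

/-- The Schur multiplier is the kernel of any central extension `τ : G → L` with kernel inside the
derived ideal which maps to the central extension `F / [R, F]` of `L`. -/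
theorem SchurMultiplier.nonempty_equiv_ker {π : FreeLieAlgebra K X →ₗ⁅K⁆ L}
    (hπ : Function.Surjective π) {τ : G →ₗ⁅K⁆ L} (hsurj : Function.Surjective τ)
    (hτ : ∀ g, τ g = 0 → ∀ h : G, ⁅g, h⁆ = 0) (hker : ∀ g, τ g = 0 → g ∈ derivedIdeal K G)
    (ψ : G →ₗ⁅K⁆ FreeLieAlgebra K X ⧸ ⁅π.ker, (⊤ : LieIdeal K (FreeLieAlgebra K X))⁆)
    (hψ : ∀ g x, ψ g = LieSubmodule.Quotient.mk x → π x = τ g) :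
    Nonempty (SchurMultiplier π ≃ₗ[K] LinearMap.ker (τ : G →ₗ[K] L)) := by
  choose σ hσ using fun x : X => hsurj (π (FreeLieAlgebra.of K x))
  let φ : FreeLieAlgebra K X →ₗ⁅K⁆ G := FreeLieAlgebra.lift K σ
  have hφ (x) : τ (φ x) = π x := by
    have : τ.comp φ = π := FreeLieAlgebra.hom_ext (fun x => by simp [φ, hσ])
    rw [← this]; rfl
  let q : FreeLieAlgebra K X →ₗ⁅K⁆
      FreeLieAlgebra K X ⧸ ⁅π.ker, (⊤ : LieIdeal K (FreeLieAlgebra K X))⁆ :=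
    { LieSubmodule.Quotient.mk' ⁅π.ker, (⊤ : LieIdeal K (FreeLieAlgebra K X))⁆ with
      map_lie' := fun {x y} => LieSubmodule.Quotient.mk_bracket _ x y }
  have hq (x) : q x = LieSubmodule.Quotient.mk x := rfl
  have hq0 (x) : q x = 0 ↔ x ∈ ⁅π.ker, (⊤ : LieIdeal K (FreeLieAlgebra K X))⁆ :=
    LieSubmodule.Quotient.mk_eq_zero'
  have hqs : Function.Surjective q := LieSubmodule.Quotient.surjective_mk' _
  -- Both maps lift `π` to the central extension $F/[R,F]$, so they differ by central elements. This
  -- gives injectivity: if `φ x = 0` with $x\in R\cap F^2$, then $x\in[R,F]$.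
  have hagree {x} (hx : x ∈ derivedIdeal K (FreeLieAlgebra K X)) : ψ (φ x) = q x := by
    refine LieHom.eq_on_derivedIdeal (f := ψ.comp φ) (g := q) (fun x b => ?_) hx
    obtain ⟨y, hy⟩ := hqs (ψ (φ x))
    obtain ⟨z, rfl⟩ := hqs b
    have : π y = π x := by rw [hψ (φ x) y (by rw [← hy, hq]), hφ]
    rw [LieHom.comp_apply, ← hy, ← map_sub, ← LieHom.map_lie, hq0]
    exact LieSubmodule.lie_mem_lie (by simp [this]) (LieSubmodule.mem_top z)
  have hzero {x} (hx : x ∈ ⁅π.ker, (⊤ : LieIdeal K (FreeLieAlgebra K X))⁆) : φ x = 0 := by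
    have hle : ⁅π.ker, (⊤ : LieIdeal K (FreeLieAlgebra K X))⁆ ≤ φ.ker := by
      rw [LieSubmodule.lie_le_iff]
      intro x hx y _
      rw [LieHom.mem_ker, LieHom.map_lie]
      exact hτ _ (by rw [hφ]; exact hx) _
    exact hle hx
  let m : (π.ker ⊓ derivedIdeal K (FreeLieAlgebra K X)).toSubmodule →ₗ[K]
      LinearMap.ker (τ : G →ₗ[K] L) :=
    ((φ : FreeLieAlgebra K X →ₗ[K] G) ∘ₗ Submodule.subtype _).codRestrict _ (fun x => by
      have : π x = 0 := x.2.1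
      rw [LinearMap.mem_ker]
      exact (hφ x).trans this)
  have hm (x) : (m x : G) = φ x := rfl
  have hms : Function.Surjective m := by
    rintro ⟨g, hg⟩
    obtain ⟨x, hx, rfl⟩ := exists_mem_derivedIdeal_of_central hπ hτ hφ (hker g hg)
    exact ⟨⟨x, ⟨(hφ x).symm.trans hg, hx⟩⟩, rfl⟩
  have hmk : LinearMap.ker m =
      (⁅π.ker, (⊤ : LieIdeal K (FreeLieAlgebra K X))⁆).toSubmodule.submoduleOf
      (π.ker ⊓ derivedIdeal K (FreeLieAlgebra K X)).toSubmodule := by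
    ext x
    rw [LinearMap.mem_ker, ← Submodule.coe_eq_zero, hm]
    constructor
    · intro h
      have h' := hagree x.2.2
      rw [h, map_zero] at h'
      exact (hq0 _).mp h'.symm
    · exact fun h => hzero h
  exact ⟨(Submodule.quotEquivOfEq _ _ hmk.symm).trans (m.quotKerEquivOfSurjective hms)⟩

end Hopf

/-! ### Counting triangles in a graph -/

section Combinatorics

open Finset

section Counting

variable {d : ℕ}

/-- The three-element sets all of whose two-element subsets lie in `E`. -/
def triangles (E : Finset (Finset (Fin d))) : Finset (Finset (Fin d)) :=
  {T ∈ powersetCard 3 univ | ∀ x ∈ T, T.erase x ∈ E}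

lemma mem_triangles {E : Finset (Finset (Fin d))} {T : Finset (Fin d)} :
    T ∈ triangles E ↔ #T = 3 ∧ ∀ x ∈ T, T.erase x ∈ E := by
  simp [triangles]

/-- A triangle has three distinct edges. -/
lemma triangles_eq_empty {E : Finset (Finset (Fin d))} (hE : #E ≤ 2) : triangles E = ∅ := by
  by_contra hne
  obtain ⟨T, hT⟩ := nonempty_iff_ne_empty.mpr hne
  rw [mem_triangles] at hT
  have h : #T ≤ #E := card_le_card_of_injOn T.erase (fun x hx => hT.2 x hx) (erase_injOn T)
  omega

/-- Double counting: a triangle with a marked vertex is determined by the opposite edge and that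
vertex, which is one of the $d-2$ points off the edge. -/
lemma three_mul_card_triangles_le {E : Finset (Finset (Fin d))} (hE : ∀ S ∈ E, #S = 2) :
    3 * #(triangles E) ≤ #E * (d - 2) := by
  have h1 : #((triangles E).sigma fun T => T) = 3 * #(triangles E) := by
    rw [card_sigma, sum_const_nat (m := 3) (fun T hT => (mem_triangles.mp hT).1), mul_comm]
  have h2 : #(E.sigma fun S => Sᶜ) = #E * (d - 2) := by
    rw [card_sigma, sum_const_nat (m := d - 2)]
    intro S hS
    rw [card_compl, hE S hS, Fintype.card_fin]
  rw [← h1, ← h2]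
  refine card_le_card_of_injOn (fun p => ⟨p.1.erase p.2, p.2⟩) ?_ ?_
  · rintro ⟨T, x⟩ h
    simp only [coe_sigma, Set.mem_sigma_iff, mem_coe] at h
    simp [(mem_triangles.mp h.1).2 x h.2]
  · rintro ⟨T, x⟩ h ⟨T', x'⟩ h' heq
    simp only [coe_sigma, Set.mem_sigma_iff, mem_coe] at h h'
    simp only [Sigma.mk.injEq, heq_eq_eq] at heq
    obtain ⟨h1, rfl⟩ := heq
    have : T = T' := by rw [← insert_erase h.2, h1, insert_erase h'.2]
    subst this; rfl

end Counting

/-! ### Bounding the kernel of the cyclic map by triangles -/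

section Kernel

variable {K V Z : Type*} [Field K] [AddCommGroup V] [Module K V] [AddCommGroup Z] [Module K Z]
  {d : ℕ} (e : Module.Basis (Fin d) K V) (β : ⋀[K]^2 V →ₗ[K] Z)

/-- The value of `β` on the wedge of the two basis vectors indexed by a two-element set. -/
noncomputable def pairValue (S : Finset (Fin d)) : Z :=
  if h : #S = 2 then β (wedge K (e (S.orderEmbOfFin h 0)) (e (S.orderEmbOfFin h 1))) else 0

lemma pairValue_eq (s : Set.powersetCard (Fin d) 2) :
    pairValue e β s = β (e.exteriorPower 2 s) := by
  have hs : #(s : Finset (Fin d)) = 2 := s.2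
  rw [pairValue, dif_pos hs, exteriorPower.basis_apply,
    exteriorPower.ιMulti_family]
  congr 2

lemma wedge_eq_pairValue {x y : Fin d} (h : x < y) :
    β (wedge K (e x) (e y)) = pairValue e β {x, y} := by
  have hs : #({x, y} : Finset (Fin d)) = 2 := card_pair h.ne
  have : (![x, y] : Fin 2 → Fin d) = ({x, y} : Finset (Fin d)).orderEmbOfFin hs := by
    refine orderEmbOfFin_unique hs (fun i => ?_) ?_
    · fin_cases i <;> simp
    · intro i j hij
      fin_cases i <;> fin_cases j <;> simp_all
  rw [pairValue, dif_pos hs, ← this]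
  rfl

/-- The pairs whose value depends linearly on the values of smaller pairs. -/
noncomputable def dependentPairs : Finset (Finset (Fin d)) := by
  classical exact
  {S ∈ powersetCard 2 univ | pairValue e β S ∈
    Submodule.span K {z | ∃ S', #S' = 2 ∧ toColex S' < toColex S ∧ pairValue e β S' = z}}

lemma mem_dependentPairs {S : Finset (Fin d)} : S ∈ dependentPairs e β ↔ #S = 2 ∧
    pairValue e β S ∈
      Submodule.span K {z | ∃ S', #S' = 2 ∧ toColex S' < toColex S ∧ pairValue e β S' = z} := by
  simp [dependentPairs]

/-- By induction along the colexicographic order, the values at the pairs that are not dependent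
already span $Z$. -/
lemma card_dependentPairs_le [FiniteDimensional K Z] (hβ : Function.Surjective β) :
    #(dependentPairs e β) + Module.finrank K Z ≤ d.choose 2 := by
  classical
  set N : Finset (Finset (Fin d)) := powersetCard 2 univ \ dependentPairs e β with hN
  have hsub : dependentPairs e β ⊆ powersetCard 2 univ := fun S hS => by
    simpa using ((mem_dependentPairs e β).mp hS).1
  have hcard : #N + #(dependentPairs e β) = d.choose 2 := by
    rw [hN, card_sdiff_add_card_eq_card hsub, card_powersetCard, card_univ, Fintype.card_fin]
  have hmem : ∀ S : Colex (Finset (Fin d)), #(ofColex S) = 2 → pairValue e β (ofColex S) ∈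
      Submodule.span K ((N.image (pairValue e β) : Finset Z) : Set Z) := by
    intro S
    have : Finite (Colex (Finset (Fin d))) := Finite.of_equiv _ toColex
    induction S using WellFoundedLT.induction with
    | ind S ih =>
      intro hS
      by_cases hD : ofColex S ∈ dependentPairs e β
      · refine Submodule.span_le.mpr ?_ ((mem_dependentPairs e β).mp hD).2
        rintro _ ⟨S', h2, hlt, rfl⟩
        exact ih (toColex S') hlt h2
      · refine Submodule.subset_span ?_
        simp only [coe_image, Set.mem_image, mem_coe]
        exact ⟨ofColex S, by simp [hN, hS, hD], rfl⟩
  have htop : Submodule.span K ((N.image (pairValue e β) : Finset Z) : Set Z) = ⊤ := by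
    rw [eq_top_iff, ← LinearMap.range_eq_top.mpr hβ, LinearMap.range_eq_map,
      ← (e.exteriorPower 2).span_eq, Submodule.map_span_le]
    rintro _ ⟨s, rfl⟩
    rw [← pairValue_eq]
    exact hmem (toColex s.1) s.2
  have := (finrank_span_finset_le_card (R := K) (N.image (pairValue e β)))
  rw [Set.finrank, htop, finrank_top] at this
  have h' : #(N.image (pairValue e β)) ≤ #N := card_image_le
  omega

/-- The coordinate of an element of `Z ⊗ V` with respect to a basis of `V`. -/
noncomputable def tensorCoord (x : Fin d) : Z ⊗[K] V →ₗ[K] Z :=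
  TensorProduct.rid K Z ∘ₗ (e.coord x).lTensor Z

@[simp]
lemma tensorCoord_tmul (x : Fin d) (z : Z) (v : V) : tensorCoord e x (z ⊗ₜ v) = e.coord x v • z := by
  simp [tensorCoord]

/-- For $i<j<l$ the image of $e_i\wedge e_j\wedge e_l$ is $\beta_{ij}\otimes e_l+\beta_{jl}\otimes
e_i-\beta_{il}\otimes e_j$: each vertex carries, up to sign, the value of the opposite edge. -/
lemma tensorCoord_cyclicMap_basis (s : Set.powersetCard (Fin d) 3) (x : Fin d) :
    (x ∉ (s : Finset (Fin d)) → tensorCoord e x (cyclicMap β (e.exteriorPower 3 s)) = 0) ∧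
    (x ∈ (s : Finset (Fin d)) → ∃ ε : K, ε ≠ 0 ∧
      tensorCoord e x (cyclicMap β (e.exteriorPower 3 s)) =
        ε • pairValue e β ((s : Finset (Fin d)).erase x)) := by
  obtain ⟨T, hT⟩ := s
  have hT' : #T = 3 := hT
  set i := T.orderEmbOfFin hT' 0 with hi
  set j := T.orderEmbOfFin hT' 1 with hj
  set l := T.orderEmbOfFin hT' 2 with hl
  have hij : i < j := (T.orderEmbOfFin hT').strictMono (by decide)
  have hjl : j < l := (T.orderEmbOfFin hT').strictMono (by decide)
  have hTe : T = {i, j, l} := by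
    ext y
    rw [← mem_coe, ← range_orderEmbOfFin T hT', Set.mem_range, mem_insert, mem_insert,
      mem_singleton]
    constructor
    · rintro ⟨n, rfl⟩
      fin_cases n
      exacts [Or.inl rfl, Or.inr (Or.inl rfl), Or.inr (Or.inr rfl)]
    · rintro (h | h | h) <;> exact ⟨_, h.symm⟩
  have hval : cyclicMap β (e.exteriorPower 3 ⟨T, hT⟩) =
      pairValue e β {i, j} ⊗ₜ e l + pairValue e β {j, l} ⊗ₜ e i -
        pairValue e β {i, l} ⊗ₜ e j := by
    rw [exteriorPower.basis_apply, exteriorPower.ιMulti_family, cyclicMap_ιMulti]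
    change β (wedge K (e i) (e j)) ⊗ₜ e l + β (wedge K (e j) (e l)) ⊗ₜ e i +
      β (wedge K (e l) (e i)) ⊗ₜ e j = _
    rw [wedge_swap (e i) (e l), map_neg, wedge_eq_pairValue e β hij, wedge_eq_pairValue e β hjl,
      wedge_eq_pairValue e β (hij.trans hjl), TensorProduct.neg_tmul, sub_eq_add_neg]
  have hil := hij.trans hjl
  clear_value i j l
  simp only [hval, map_add, map_sub, tensorCoord_tmul, Module.Basis.coord_apply,
    Module.Basis.repr_self, Finsupp.single_apply]
  change (x ∉ T → _) ∧ (x ∈ T → ∃ ε : K, ε ≠ 0 ∧ _ = ε • pairValue e β (T.erase x))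
  rw [hTe]
  refine ⟨fun hx => ?_, fun hx => ?_⟩
  · simp only [mem_insert, mem_singleton, not_or] at hx
    simp [Ne.symm hx.1, Ne.symm hx.2.1, Ne.symm hx.2.2]
  · simp only [mem_insert, mem_singleton] at hx
    rcases hx with rfl | rfl | rfl
    · refine ⟨1, one_ne_zero, ?_⟩
      have : ({x, j, l} : Finset (Fin d)).erase x = {j, l} := by
        apply erase_insert; simp [hij.ne, hil.ne]
      simp [this, hij.ne', hil.ne']
    · refine ⟨-1, neg_ne_zero.mpr one_ne_zero, ?_⟩
      have : ({i, x, l} : Finset (Fin d)).erase x = {i, l} := by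
        rw [insert_comm]; apply erase_insert; simp [hij.ne', hjl.ne]
      simp [this, hij.ne, hjl.ne']
    · refine ⟨1, one_ne_zero, ?_⟩
      have : ({i, j, x} : Finset (Fin d)).erase x = {i, j} := by
        rw [pair_comm j x, insert_comm]
        apply erase_insert; simp [hil.ne', hjl.ne']
      simp [this, hil.ne, hjl.ne]

/-- An element of the kernel of the cyclic map whose coordinates at the triangles of dependent
pairs vanish is zero. -/
lemma eq_zero_of_cyclicMap_eq_zero {a : ⋀[K]^3 V} (ha : cyclicMap β a = 0)
    (htri : ∀ s : Set.powersetCard (Fin d) 3, (s : Finset (Fin d)) ∈ triangles (dependentPairs e β) →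
      (e.exteriorPower 3).repr a s = 0) : a = 0 := by
  classical
  by_contra hne
  set c := (e.exteriorPower 3).repr a with hc
  have hcne : c.support.Nonempty := by
    rw [Finsupp.support_nonempty_iff, hc]
    simpa using hne
  -- Leading term: the colexicographically largest triple in the support. It is not a triangle of
  -- dependent pairs, so one of its edges is not dependent; the coordinate at the opposite vertex
  -- `x` will show that it is.
  obtain ⟨s, hs, hmax⟩ := c.support.exists_max_image (fun s => toColex (s : Finset (Fin d))) hcne
  have hs0 : c s ≠ 0 := by simpa using hs
  have hns : ¬ (s : Finset (Fin d)) ∈ triangles (dependentPairs e β) := fun h => hs0 (htri s h)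
  rw [mem_triangles] at hns
  push Not at hns
  obtain ⟨x, hx, hxE⟩ := hns s.2
  have hcard : ∀ t : Set.powersetCard (Fin d) 3, x ∈ (t : Finset (Fin d)) →
      #((t : Finset (Fin d)).erase x) = 2 := fun t ht => by
    rw [card_erase_of_mem ht, show #(t : Finset (Fin d)) = 3 from t.2]
  refine hxE ((mem_dependentPairs e β).mpr ⟨hcard s hx, ?_⟩)
  set W := Submodule.span K {z | ∃ S', #S' = 2 ∧ toColex S' < toColex ((s : Finset (Fin d)).erase x) ∧
    pairValue e β S' = z} with hW
  have hsum : ∑ t ∈ c.support, c t • tensorCoord e x (cyclicMap β (e.exteriorPower 3 t)) = 0 := by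
    have h := congrArg (tensorCoord e x) ha
    rw [← (e.exteriorPower 3).linearCombination_repr a, Finsupp.linearCombination_apply,
      Finsupp.sum] at h
    simpa using h
  rw [← add_sum_erase _ _ hs, add_eq_zero_iff_eq_neg] at hsum
  obtain ⟨ε, hε, hεs⟩ := (tensorCoord_cyclicMap_basis e β s x).2 hx
  have hmem : c s • tensorCoord e x (cyclicMap β (e.exteriorPower 3 s)) ∈ W := by
    rw [hsum]
    refine W.neg_mem (W.sum_mem fun t ht => W.smul_mem _ ?_)
    obtain ⟨hts, ht⟩ := mem_erase.mp ht
    by_cases hxt : x ∈ (t : Finset (Fin d))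
    · obtain ⟨η, -, hη⟩ := (tensorCoord_cyclicMap_basis e β t x).2 hxt
      rw [hη]
      refine W.smul_mem _ (Submodule.subset_span ⟨_, hcard t hxt, ?_, rfl⟩)
      have hlt : toColex (t : Finset (Fin d)) < toColex (s : Finset (Fin d)) :=
        lt_of_le_of_ne (hmax t ht) fun h => hts (Subtype.ext (toColex_inj.mp h))
      -- Removing a common element preserves the colexicographic order, so the other edges opposite
      -- `x` come earlier.
      rw [← sdiff_singleton_eq_erase, ← sdiff_singleton_eq_erase,
        Colex.toColex_sdiff_lt_toColex_sdiff (by simpa using hxt) (by simpa using hx)]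
      exact hlt
    · rw [(tensorCoord_cyclicMap_basis e β t x).1 hxt]
      exact W.zero_mem
  rw [hεs, smul_smul] at hmem
  exact (W.smul_mem_iff (mul_ne_zero hs0 hε)).mp hmem

lemma finrank_ker_cyclicMap_le :
    Module.finrank K (cyclicMap β).ker ≤ #(triangles (dependentPairs e β)) := by
  classical
  have : FiniteDimensional K V := e.finiteDimensional_of_finite
  let I := {T // T ∈ triangles (dependentPairs e β)}
  let f : (cyclicMap β).ker →ₗ[K] I → K :=
    LinearMap.pi (fun T => (e.exteriorPower 3).coord ⟨T.1, (mem_triangles.mp T.2).1⟩) ∘ₗ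
      Submodule.subtype _
  have hf : Function.Injective f := by
    rw [injective_iff_map_eq_zero]
    intro a ha
    refine Subtype.ext (eq_zero_of_cyclicMap_eq_zero e β a.2 fun s hs => ?_)
    exact congrFun ha ⟨s, hs⟩
  have h := LinearMap.finrank_le_finrank_of_injective hf
  rwa [Module.finrank_fintype_fun_eq_card, Fintype.card_coe] at h

end Kernel

end Combinatorics

/-! ### Lie algebras of class two and their covers -/

section ClassTwo

variable {K L V : Type*} [Field K] [LieRing L] [LieAlgebra K L] [AddCommGroup V] [Module K V]

/-- The commutator map `⋀²V → L²` on the image of a linear map `s : V → L`. -/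
noncomputable def commutatorMap (s : V →ₗ[K] L) : ⋀[K]^2 V →ₗ[K] derivedIdeal K L :=
  wedgeLift (LinearMap.mk₂ K (fun x y => ⟨⁅s x, s y⁆, lie_mem_derivedIdeal _ _⟩)
    (fun x x' y => Subtype.ext (by simp)) (fun c x y => Subtype.ext (by simp))
    (fun x y y' => Subtype.ext (by simp)) (fun c x y => Subtype.ext (by simp)))
    (fun x => Subtype.ext (by simp))

@[simp]
lemma commutatorMap_wedge (s : V →ₗ[K] L) (x y : V) :
    (commutatorMap s (wedge K x y) : L) = ⁅s x, s y⁆ := by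
  simp [commutatorMap]

variable (q : L →ₗ[K] V) (s : V →ₗ[K] L)

section

variable {q s} (hqs : ∀ v, q (s v) = v) (hq : ∀ x, q x = 0 ↔ x ∈ derivedIdeal K L)
  (hcl : ∀ z ∈ derivedIdeal K L, ∀ x : L, ⁅z, x⁆ = 0)

include hqs hq in
lemma sub_section_mem (x : L) : x - s (q x) ∈ derivedIdeal K L := by
  rw [← hq, map_sub, hqs, sub_self]

include hqs hq hcl in
lemma lie_section (x y : L) : ⁅s (q x), s (q y)⁆ = ⁅x, y⁆ := by
  have h1 (b : L) : ⁅x, b⁆ = ⁅s (q x), b⁆ := by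
    rw [← sub_eq_zero, ← sub_lie, hcl _ (sub_section_mem hqs hq x)]
  have h2 (b : L) : ⁅b, y⁆ = ⁅b, s (q y)⁆ := by
    rw [← sub_eq_zero, ← lie_sub, ← lie_skew, hcl _ (sub_section_mem hqs hq y), neg_zero]
  rw [h1, h2]

include hqs hq hcl in
lemma commutatorMap_surjective : Function.Surjective (commutatorMap s) := by
  rintro ⟨z, hz⟩
  suffices h : z ∈ ((derivedIdeal K L).toSubmodule.subtype ∘ₗ commutatorMap s).range by
    obtain ⟨a, ha⟩ := h
    exact ⟨a, Subtype.ext ha⟩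
  refine derivedIdeal_le (fun x y => LinearMap.mem_range.mpr ⟨wedge K (q x) (q y), ?_⟩) hz
  rw [LinearMap.comp_apply, Submodule.subtype_apply, commutatorMap_wedge,
    lie_section hqs hq hcl]

end

namespace Cover

/-- The projection of the cover to `L`, as a linear map. -/
noncomputable def projLinear : Cover (commutatorMap s) →ₗ[K] L :=
  s ∘ₗ deg₁ (commutatorMap s) +
    (derivedIdeal K L).toSubmodule.subtype ∘ₗ commutatorMap s ∘ₗ deg₂ (commutatorMap s)

lemma projLinear_apply (g : Cover (commutatorMap s)) :
    projLinear s g = s (deg₁ _ g) + commutatorMap s (deg₂ _ g) := rfl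

variable {s} (hcl : ∀ z ∈ derivedIdeal K L, ∀ x : L, ⁅z, x⁆ = 0)

/-- The projection of the cover to `L`. -/
noncomputable def proj : Cover (commutatorMap s) →ₗ⁅K⁆ L where
  __ := projLinear s
  map_lie' {g h} := by
    change projLinear s ⁅g, h⁆ = ⁅projLinear s g, projLinear s h⁆
    have h1 (z : derivedIdeal K L) (x : L) : ⁅(z : L), x⁆ = 0 := hcl z z.2 x
    have h2 (z : derivedIdeal K L) (x : L) : ⁅x, (z : L)⁆ = 0 := by
      rw [← lie_skew, h1, neg_zero]
    simp [projLinear_apply, lie_def, h1, h2, wedgeBilin_apply]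

lemma proj_apply (g : Cover (commutatorMap s)) :
    proj hcl g = s (deg₁ _ g) + commutatorMap s (deg₂ _ g) := rfl

variable {q} (hqs : ∀ v, q (s v) = v) (hq : ∀ x, q x = 0 ↔ x ∈ derivedIdeal K L)

include hqs hq in
lemma proj_surjective : Function.Surjective (proj hcl (s := s)) := by
  intro x
  obtain ⟨a, ha⟩ := commutatorMap_surjective hqs hq hcl ⟨_, sub_section_mem hqs hq x⟩
  exact ⟨mk (q x) a 0, by simp [proj_apply, ha]⟩

include hqs hq in
lemma proj_eq_zero_iff (g : Cover (commutatorMap s)) :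
    proj hcl g = 0 ↔ deg₁ _ g = 0 ∧ commutatorMap s (deg₂ _ g) = 0 := by
  constructor
  · intro h
    have h1 : deg₁ _ g = 0 := by
      have := congrArg q h
      rwa [proj_apply, map_add, hqs, (hq _).mpr (commutatorMap s (deg₂ _ g)).2, add_zero,
        map_zero] at this
    exact ⟨h1, Subtype.ext (by simpa [proj_apply, h1] using h)⟩
  · rintro ⟨h1, h2⟩
    simp [proj_apply, h1, h2]

include hqs hq in
lemma lie_eq_zero_of_proj_eq_zero (g : Cover (commutatorMap s)) (hg : proj hcl g = 0)
    (h : Cover (commutatorMap s)) : ⁅g, h⁆ = 0 := by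
  obtain ⟨h1, h2⟩ := (proj_eq_zero_iff hcl hqs hq g).mp hg
  ext <;> simp [lie_def, h1, h2]

-- Surjectivity of `β` is what makes every $z\otimes v$ a commutator, namely of a preimage of $z$ in
-- degree two with $v$.
omit [LieAlgebra K L] [LieRing L] in
lemma mk_mem_derivedIdeal {Z : Type*} [AddCommGroup Z] [Module K Z] {β : ⋀[K]^2 V →ₗ[K] Z}
    (hβ : Function.Surjective β) (a : ⋀[K]^2 V) (w : CyclicQuotient β) :
    mk 0 a w ∈ derivedIdeal K (Cover β) := by
  have h3 : ∀ w : CyclicQuotient β, mk 0 0 w ∈ derivedIdeal K (Cover β) := by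
    intro w
    obtain ⟨t, rfl⟩ := Submodule.mkQ_surjective _ w
    induction t using TensorProduct.induction_on with
    | zero => rw [map_zero]; exact zero_mem (derivedIdeal K (Cover β))
    | tmul z v =>
      obtain ⟨a, rfl⟩ := hβ z
      convert lie_mem_derivedIdeal (K := K) (mk 0 a 0 : Cover β) (mk v 0 0) using 1
      ext <;> simp [lie_def, cls]
    | add x y hx hy =>
      convert add_mem hx hy using 1
      ext <;> simp
  have h2 : mk 0 a 0 ∈ derivedIdeal K (Cover β) := by
    induction a using wedge_induction with
    | h0 => exact zero_mem (derivedIdeal K (Cover β))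
    | hadd a b ha hb =>
      convert add_mem ha hb using 1
      ext <;> simp
    | hsmul c a ha =>
      have h : mk 0 (c • a) 0 = c • (mk 0 a 0 : Cover β) := by ext <;> simp
      exact h ▸ (derivedIdeal K (Cover β)).smul_mem c ha
    | h x y =>
      convert lie_mem_derivedIdeal (K := K) (mk x 0 0 : Cover β) (mk y 0 0) using 1
      ext <;> simp [lie_def, wedgeBilin_apply]
  convert add_mem h2 (h3 w) using 1
  ext <;> simp

include hqs hq in
lemma mem_derivedIdeal_of_proj_eq_zero (g : Cover (commutatorMap s)) (hg : proj hcl g = 0) :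
    g ∈ derivedIdeal K (Cover (commutatorMap s)) := by
  have h1 := ((proj_eq_zero_iff hcl hqs hq g).mp hg).1
  convert mk_mem_derivedIdeal (commutatorMap_surjective hqs hq hcl) (deg₂ _ g) (deg₃ _ g) using 1
  ext <;> simp [h1]

/-! ### Mapping the cover to an arbitrary central extension -/

section Lift

variable {E : Type*} [LieRing E] [LieAlgebra K E] {ε : E →ₗ⁅K⁆ L}
  (hε : ∀ x, ε x = 0 → ∀ y : E, ⁅x, y⁆ = 0) {t : L →ₗ[K] E} (ht : ∀ x, ε (t x) = x)

include hε in
lemma lie_congr_of_central {x x' y y' : E} (hx : ε x = ε x') (hy : ε y = ε y') :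
    ⁅x, y⁆ = ⁅x', y'⁆ := by
  have h1 : ⁅x, y⁆ = ⁅x', y⁆ := by
    rw [← sub_eq_zero, ← sub_lie, hε _ (by rw [map_sub, hx, sub_self])]
  have h2 : ⁅x', y⁆ = ⁅x', y'⁆ := by
    rw [← sub_eq_zero, ← lie_sub, ← lie_skew, hε _ (by rw [map_sub, hy, sub_self]), neg_zero]
  rw [h1, h2]

-- For $z=[x,y]$, replace $t[x,y]$ by $[tx,ty]$, which has the same image in $L$. The Jacobi
-- identity leaves terms containing $[tx,tz']$ or $[ty,tz']$, which lie over $0$ and so are central.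
include hε ht hcl in
lemma lie_section_eq_zero {z z' : L} (hz : z ∈ derivedIdeal K L) (hz' : z' ∈ derivedIdeal K L) :
    ⁅t z, t z'⁆ = 0 := by
  suffices h : z ∈ LinearMap.ker ((LieModule.toEnd K E E : E →ₗ[K] Module.End K E).flip (t z') ∘ₗ t)
    by simpa using h
  refine derivedIdeal_le (fun x y => ?_) hz
  have h0 (x : L) (w : E) : ⁅w, ⁅t x, t z'⁆⁆ = 0 := by
    rw [← lie_skew, hε _ (by rw [LieHom.map_lie, ht, ht, ← lie_skew, hcl z' hz', neg_zero]),
      neg_zero]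
  have h1 : ⁅t ⁅x, y⁆, t z'⁆ = ⁅⁅t x, t y⁆, t z'⁆ :=
    lie_congr_of_central hε (by simp [ht]) rfl
  have : ⁅t ⁅x, y⁆, t z'⁆ = 0 := by
    rw [h1, lie_lie, h0, h0, sub_zero]
  simpa using this

/-- The degree two part of the lift of the cover to a central extension. -/
noncomputable def lift₂ (s : V →ₗ[K] L) (t : L →ₗ[K] E) : ⋀[K]^2 V →ₗ[K] E :=
  wedgeLift (LinearMap.mk₂ K (fun x y => ⁅t (s x), t (s y)⁆)
    (fun x x' y => by simp) (fun c x y => by simp)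
    (fun x y y' => by simp) (fun c x y => by simp)) (fun x => by simp)

lemma lift₂_wedge (x y : V) : lift₂ s t (wedge K x y) = ⁅t (s x), t (s y)⁆ := by
  simp [lift₂]

include ht in
lemma map_lift₂ (a : ⋀[K]^2 V) : ε (lift₂ s t a) = commutatorMap s a := by
  induction a using wedge_induction with
  | h0 => simp
  | hadd a b ha hb => simp [ha, hb]
  | hsmul c a ha => simp [ha]
  | h x y => simp [lift₂_wedge, ht, commutatorMap_wedge]

/-- The degree three part of the lift of the cover to a central extension, before passing to
the quotient. -/
noncomputable def lift₃Aux (s : V →ₗ[K] L) (t : L →ₗ[K] E) : derivedIdeal K L ⊗[K] V →ₗ[K] E :=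
  TensorProduct.lift (LinearMap.mk₂ K (fun z v => ⁅t z, t (s v)⁆)
    (fun x x' y => by simp) (fun c x y => by simp)
    (fun x y y' => by simp) (fun c x y => by simp))

lemma lift₃Aux_tmul (z : derivedIdeal K L) (v : V) :
    lift₃Aux s t (z ⊗ₜ v) = ⁅t z, t (s v)⁆ := by
  simp [lift₃Aux]

-- The cyclic sums become Jacobi sums in `E`, which is why the lift descends to the quotient.
include hε ht in
lemma range_cyclicMap_le_ker : (cyclicMap (commutatorMap s)).range ≤ (lift₃Aux s t).ker := by
  rw [LinearMap.range_le_ker_iff]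
  refine exteriorPower.linearMap_ext (AlternatingMap.ext fun v => ?_)
  have h (x y z : V) : ⁅t ⁅s x, s y⁆, t (s z)⁆ = ⁅⁅t (s x), t (s y)⁆, t (s z)⁆ :=
    lie_congr_of_central hε (by simp [ht]) rfl
  simp only [LinearMap.compAlternatingMap_apply, LinearMap.comp_apply, cyclicMap_ιMulti, map_add,
    lift₃Aux_tmul, commutatorMap_wedge, h, LinearMap.zero_apply]
  have := lie_jacobi (t (s (v 0))) (t (s (v 1))) (t (s (v 2)))
  rw [← lie_skew _ ⁅t (s (v 1)), _⁆, ← lie_skew _ ⁅t (s (v 2)), _⁆,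
    ← lie_skew _ ⁅t (s (v 0)), _⁆] at this
  rw [← neg_eq_zero, ← this]
  abel

/-- The degree three part of the lift of the cover to a central extension. -/
noncomputable def lift₃ : CyclicQuotient (commutatorMap s) →ₗ[K] E :=
  (cyclicMap (commutatorMap s)).range.liftQ (lift₃Aux s t) (range_cyclicMap_le_ker hε ht)

lemma lift₃_cls (z : derivedIdeal K L) (v : V) :
    lift₃ hε ht (cls (commutatorMap s) z v) = ⁅t z, t (s v)⁆ := by
  rw [← lift₃Aux_tmul]; rfl

include hcl in
lemma map_lift₃ (w : CyclicQuotient (commutatorMap s)) : ε (lift₃ hε ht w) = 0 := by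
  obtain ⟨u, rfl⟩ := Submodule.mkQ_surjective _ w
  induction u using TensorProduct.induction_on with
  | zero => simp
  | tmul z v =>
    change ε (lift₃ hε ht (cls _ z v)) = 0
    rw [lift₃_cls, LieHom.map_lie, ht, ht, hcl z z.2]
  | add x y hx hy => rw [map_add, map_add, map_add, hx, hy, add_zero]

/-- A central extension of `L` receives a homomorphism from the cover. -/
noncomputable def lift : Cover (commutatorMap s) →ₗ⁅K⁆ E where
  __ := t ∘ₗ s ∘ₗ deg₁ _ + lift₂ s t ∘ₗ deg₂ _ + lift₃ hε ht ∘ₗ deg₃ _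
  map_lie' {g h} := by
    change t (s (deg₁ _ ⁅g, h⁆)) + lift₂ s t (deg₂ _ ⁅g, h⁆) + lift₃ hε ht (deg₃ _ ⁅g, h⁆) =
      ⁅t (s (deg₁ _ g)) + lift₂ s t (deg₂ _ g) + lift₃ hε ht (deg₃ _ g),
        t (s (deg₁ _ h)) + lift₂ s t (deg₂ _ h) + lift₃ hε ht (deg₃ _ h)⁆
    -- Brackets in `E` depend only on images in $L$, so the lift of `g` may be replaced by a sum of
    -- values of the section `t`.
    have key (g : Cover (commutatorMap s)) :
        ε (t (s (deg₁ _ g)) + lift₂ s t (deg₂ _ g) + lift₃ hε ht (deg₃ _ g)) =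
          ε (t (s (deg₁ _ g)) + t (commutatorMap s (deg₂ _ g))) := by
      simp [map_lift₃ hcl, map_lift₂ ht, ht]
    rw [lie_congr_of_central hε (key g) (key h)]
    simp only [lie_def, deg₁_mk, deg₂_mk, deg₃_mk, map_zero, map_sub, lift₃_cls, wedgeBilin_apply,
      lift₂_wedge, lie_add, add_lie, zero_add]
    rw [lie_section_eq_zero hcl hε ht (commutatorMap s (deg₂ _ g)).2
      (commutatorMap s (deg₂ _ h)).2, ← lie_skew (t (commutatorMap s (deg₂ _ h) : L))]
    abel

lemma map_lift (g : Cover (commutatorMap s)) : ε (lift hcl hε ht g) = proj hcl g := by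
  change ε (t (s (deg₁ _ g)) + lift₂ s t (deg₂ _ g) + lift₃ hε ht (deg₃ _ g)) = _
  rw [map_add, map_add, ht, map_lift₂ ht, map_lift₃ hcl, add_zero, proj_apply]

end Lift

end Cover

end ClassTwo

/-! ### The dimension of the multiplier -/

section SchurMultiplierDimension

variable {K L V X : Type*} [Field K] [LieRing L] [LieAlgebra K L] [AddCommGroup V] [Module K V]
  {q : L →ₗ[K] V} {s : V →ₗ[K] L}

/-- The Schur multiplier of a Lie algebra of class two is the kernel of the projection from the
cover. -/
theorem SchurMultiplier.nonempty_equiv_ker_proj (hqs : ∀ v, q (s v) = v)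
    (hq : ∀ x, q x = 0 ↔ x ∈ derivedIdeal K L) (hcl : ∀ z ∈ derivedIdeal K L, ∀ x : L, ⁅z, x⁆ = 0)
    {π : FreeLieAlgebra K X →ₗ⁅K⁆ L} (hπ : Function.Surjective π) :
    Nonempty (SchurMultiplier π ≃ₗ[K]
      LinearMap.ker (Cover.proj hcl (s := s) : Cover (commutatorMap s) →ₗ[K] L)) := by
  let R := ⁅π.ker, (⊤ : LieIdeal K (FreeLieAlgebra K X))⁆
  have hR : R.toSubmodule ≤ LinearMap.ker (π : FreeLieAlgebra K X →ₗ[K] L) :=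
    LieSubmodule.lie_le_left π.ker ⊤
  let ε : FreeLieAlgebra K X ⧸ R →ₗ⁅K⁆ L :=
    { R.toSubmodule.liftQ (π : FreeLieAlgebra K X →ₗ[K] L) hR with
      map_lie' := by
        intro x y
        obtain ⟨x, rfl⟩ := LieSubmodule.Quotient.surjective_mk' R x
        obtain ⟨y, rfl⟩ := LieSubmodule.Quotient.surjective_mk' R y
        exact LieHom.map_lie π x y }
  have hεmk (x) : ε (LieSubmodule.Quotient.mk x) = π x := rfl
  have hε : ∀ x, ε x = 0 → ∀ y : FreeLieAlgebra K X ⧸ R, ⁅x, y⁆ = 0 := by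
    intro x hx y
    obtain ⟨x, rfl⟩ := LieSubmodule.Quotient.surjective_mk' R x
    obtain ⟨y, rfl⟩ := LieSubmodule.Quotient.surjective_mk' R y
    exact LieSubmodule.Quotient.mk_eq_zero'.mpr
      (LieSubmodule.lie_mem_lie (show x ∈ π.ker from hx) (LieSubmodule.mem_top y))
  have hεs : Function.Surjective ε := fun x => by
    obtain ⟨y, rfl⟩ := hπ x
    exact ⟨LieSubmodule.Quotient.mk y, rfl⟩
  -- A section of the central extension $F/[R,F]\to L$, linear only.
  obtain ⟨t, ht⟩ := (ε : FreeLieAlgebra K X ⧸ R →ₗ[K] L).exists_rightInverse_of_surjective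
    (LinearMap.range_eq_top.mpr hεs)
  have ht' (x) : ε (t x) = x := LinearMap.congr_fun ht x
  refine SchurMultiplier.nonempty_equiv_ker hπ (Cover.proj_surjective hcl hqs hq)
    (Cover.lie_eq_zero_of_proj_eq_zero hcl hqs hq)
    (Cover.mem_derivedIdeal_of_proj_eq_zero hcl hqs hq) (Cover.lift hcl hε ht') fun g x h => ?_
  rw [← hεmk, ← h, Cover.map_lift]

instance Cover.finiteDimensional {Z : Type*} [AddCommGroup Z] [Module K Z] [FiniteDimensional K V]
    [FiniteDimensional K Z] (β : ⋀[K]^2 V →ₗ[K] Z) : FiniteDimensional K (Cover β) :=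
  inferInstanceAs (FiniteDimensional K (V × ⋀[K]^2 V × CyclicQuotient β))

lemma Cover.finrank_add {Z : Type*} [AddCommGroup Z] [Module K Z] [FiniteDimensional K V]
    [FiniteDimensional K Z] (β : ⋀[K]^2 V →ₗ[K] Z) :
    Module.finrank K (Cover β) + (Module.finrank K V).choose 3 =
      Module.finrank K V + (Module.finrank K V).choose 2 +
        Module.finrank K Z * Module.finrank K V + Module.finrank K (cyclicMap β).ker := by
  have h1 : Module.finrank K (Cover β) = Module.finrank K (V × ⋀[K]^2 V × CyclicQuotient β) := rfl
  have h2 : Module.finrank K (CyclicQuotient β) + Module.finrank K (cyclicMap β).range =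
      Module.finrank K (Z ⊗[K] V) := (cyclicMap β).range.finrank_quotient_add_finrank
  have h3 := (cyclicMap β).finrank_range_add_finrank_ker
  rw [Module.finrank_tensorProduct] at h2
  rw [exteriorPower.finrank_eq] at h3
  rw [h1, Module.finrank_prod, Module.finrank_prod, exteriorPower.finrank_eq]
  omega

lemma finiteDimensional_of_section [FiniteDimensional K V] (hqs : ∀ v, q (s v) = v)
    (hq : ∀ x, q x = 0 ↔ x ∈ derivedIdeal K L)
    (hcl : ∀ z ∈ derivedIdeal K L, ∀ x : L, ⁅z, x⁆ = 0) : FiniteDimensional K L := by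
  have : FiniteDimensional K (derivedIdeal K L) :=
    Module.Finite.of_surjective _ (commutatorMap_surjective hqs hq hcl)
  exact Module.Finite.of_surjective (Cover.proj hcl (s := s) : Cover (commutatorMap s) →ₗ[K] L)
    (Cover.proj_surjective hcl hqs hq)

lemma finrank_eq_of_section [FiniteDimensional K V] [FiniteDimensional K L]
    (hqs : ∀ v, q (s v) = v) (hq : ∀ x, q x = 0 ↔ x ∈ derivedIdeal K L) :
    Module.finrank K L = Module.finrank K V + Module.finrank K (derivedIdeal K L) := by
  have h := q.finrank_range_add_finrank_ker
  have hk : q.ker = (derivedIdeal K L).toSubmodule := Submodule.ext hq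
  rw [LinearMap.range_eq_top.mpr (fun v => ⟨s v, hqs v⟩), finrank_top, hk] at h
  exact h.symm

/-- The dimension of the Schur multiplier of a Lie algebra of class two. -/
theorem SchurMultiplier.finrank_add [FiniteDimensional K V] (hqs : ∀ v, q (s v) = v)
    (hq : ∀ x, q x = 0 ↔ x ∈ derivedIdeal K L) (hcl : ∀ z ∈ derivedIdeal K L, ∀ x : L, ⁅z, x⁆ = 0)
    {π : FreeLieAlgebra K X →ₗ⁅K⁆ L} (hπ : Function.Surjective π) :
    FiniteDimensional K (SchurMultiplier π) ∧
    Module.finrank K (SchurMultiplier π) + Module.finrank K (derivedIdeal K L) +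
        (Module.finrank K V).choose 3 =
      (Module.finrank K V).choose 2 + Module.finrank K (derivedIdeal K L) * Module.finrank K V +
        Module.finrank K (cyclicMap (commutatorMap s)).ker := by
  have hL := finiteDimensional_of_section hqs hq hcl
  obtain ⟨f⟩ := SchurMultiplier.nonempty_equiv_ker_proj hqs hq hcl hπ (s := s)
  refine ⟨Module.Finite.equiv f.symm, ?_⟩
  have h1 := (Cover.proj hcl (s := s) :
    Cover (commutatorMap s) →ₗ[K] L).finrank_range_add_finrank_ker
  rw [LinearMap.range_eq_top.mpr (Cover.proj_surjective hcl hqs hq), finrank_top,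
    ← f.finrank_eq, finrank_eq_of_section hqs hq] at h1
  have h2 := Cover.finrank_add (commutatorMap s)
  omega

end SchurMultiplierDimension

/-! ### Minimal number of generators -/

section Generators

variable {K L V : Type*} [Field K] [LieRing L] [LieAlgebra K L] [AddCommGroup V] [Module K V]
  {q : L →ₗ[K] V} {s : V →ₗ[K] L}

/-- The minimal number of generators of a Lie algebra of class two is the dimension of its
abelianization. -/
theorem IsMinimallyGeneratedBy.finrank_eq {d : ℕ} (hd : IsMinimallyGeneratedBy K L d)
    (hqs : ∀ v, q (s v) = v)
    (hq : ∀ x, q x = 0 ↔ x ∈ derivedIdeal K L)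
    (hcl : ∀ z ∈ derivedIdeal K L, ∀ x : L, ⁅z, x⁆ = 0) :
    FiniteDimensional K V ∧ Module.finrank K V = d := by
  classical
  obtain ⟨⟨S, hSc, hS⟩, hmin⟩ := hd
  have htop : Submodule.span K ((S.image q : Finset V) : Set V) = ⊤ := by
    -- The preimage of any subspace of `V` is a subalgebra, since it contains all commutators.
    let H : LieSubalgebra K L :=
      { (Submodule.span K ((S.image q : Finset V) : Set V)).comap q with
        lie_mem' := fun {x y} _ _ => by
          change q ⁅x, y⁆ ∈ Submodule.span K _
          rw [(hq _).mpr (lie_mem_derivedIdeal x y)]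
          exact zero_mem _ }
    have hH : LieSubalgebra.lieSpan K L (S : Set L) ≤ H := by
      rw [LieSubalgebra.lieSpan_le]
      intro x hx
      exact Submodule.subset_span (Finset.mem_coe.mpr (Finset.mem_image_of_mem q hx))
    rw [eq_top_iff]
    intro v _
    have : s v ∈ H := hH (hS ▸ LieSubalgebra.mem_top (s v))
    rw [← hqs v]
    exact this
  have hfin : FiniteDimensional K V := ⟨⟨_, htop⟩⟩
  refine ⟨hfin, le_antisymm ?_ ?_⟩
  · have h := finrank_span_finset_le_card (R := K) (S.image q)
    rw [Set.finrank, htop, finrank_top] at h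
    exact h.trans (Finset.card_image_le.trans hSc.le)
  · let b := Module.finBasis K V
    refine hmin ⟨Finset.univ.image fun i => s (b i), ?_, ?_⟩
    · rw [Finset.card_image_of_injective, Finset.card_univ, Fintype.card_fin]
      exact (Function.LeftInverse.injective hqs).comp b.injective
    · set H := LieSubalgebra.lieSpan K L ((Finset.univ.image fun i => s (b i) : Finset L) : Set L)
        with hH
      have hs (v : V) : s v ∈ H := by
        suffices h : (⊤ : Submodule K V) ≤ H.toSubmodule.comap s from h trivial
        rw [← b.span_eq, Submodule.span_le]
        rintro _ ⟨i, rfl⟩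
        exact LieSubalgebra.subset_lieSpan (by simp)
      -- Commutators are unchanged when both entries move by central elements, so lifts of a basis
      -- of `V` also generate $L^2$.
      have hD {x : L} (hx : x ∈ derivedIdeal K L) : x ∈ H := by
        refine derivedIdeal_le (S := H.toSubmodule) (fun x y => ?_) hx
        rw [← lie_section hqs hq hcl]
        exact H.lie_mem (hs _) (hs _)
      rw [eq_top_iff]
      intro x _
      have := H.add_mem (hs (q x)) (hD (sub_section_mem hqs hq x))
      rwa [add_sub_cancel] at this

end Generators

/-! ### Arithmetic and conclusion -/

lemma Nat.cast_choose_three_rat (d : ℕ) :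
    (d.choose 3 : ℚ) = d * (d - 1) * (d - 2) / 6 := by
  induction d with
  | zero => simp
  | succ n ih =>
    rw [Nat.choose_succ_succ' n 2, Nat.cast_add, ih, Nat.cast_choose_two]
    push_cast
    ring

theorem mainTheorem6 {K L X : Type*} [Field K] [LieRing L] [LieAlgebra K L] (d : ℕ)
    (hd : IsMinimallyGeneratedBy K L d) (hL : IsGeneralizedHeisenberg K L)
    (π : FreeLieAlgebra K X →ₗ⁅K⁆ L) (hπ : Function.Surjective π) :
    FiniteDimensional K L ∧ FiniteDimensional K (SchurMultiplier π) ∧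
    ((Module.finrank K (derivedIdeal K L) : ℚ) = (d : ℚ) * (d - 1) / 2 - 1 ↔
      (Module.finrank K (SchurMultiplier π) : ℚ) = (d : ℚ) * (d - 1) * (d + 1) / 3 - d + 1) ∧
    ((Module.finrank K (derivedIdeal K L) : ℚ) = (d : ℚ) * (d - 1) / 2 - 2 ↔
      (Module.finrank K (SchurMultiplier π) : ℚ) =
        (d : ℚ) * (d - 1) * (d + 1) / 3 - 2 * d + 2) := by
  have hcl : ∀ z ∈ derivedIdeal K L, ∀ x : L, ⁅z, x⁆ = 0 := by
    intro z hz x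
    rw [hL, LieModule.mem_maxTrivSubmodule] at hz
    rw [← lie_skew, hz, neg_zero]
  let q := (derivedIdeal K L).toSubmodule.mkQ
  obtain ⟨s, hs⟩ := q.exists_rightInverse_of_surjective
    (LinearMap.range_eq_top.mpr (Submodule.mkQ_surjective _))
  have hqs (v) : q (s v) = v := LinearMap.congr_fun hs v
  have hq (x) : q x = 0 ↔ x ∈ derivedIdeal K L := by simp [q]
  obtain ⟨hV, hVd⟩ := hd.finrank_eq hqs hq hcl
  have hLfin := finiteDimensional_of_section hqs hq hcl
  obtain ⟨hM, hdim⟩ := SchurMultiplier.finrank_add hqs hq hcl hπ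
  refine ⟨hLfin, hM, ?_⟩
  let e := Module.finBasisOfFinrankEq K _ hVd
  have hsurj := commutatorMap_surjective hqs hq hcl
  have hE := card_dependentPairs_le e (commutatorMap s) hsurj
  have hn := finrank_ker_cyclicMap_le e (commutatorMap s)
  have htri := three_mul_card_triangles_le (E := dependentPairs e (commutatorMap s))
    (fun S hS => ((mem_dependentPairs e _).mp hS).1)
  have htri0 := triangles_eq_empty (E := dependentPairs e (commutatorMap s))
  -- The coefficient $d-1$ of $k$ must not vanish. If $d=1$ then $L^2=0$, so $L=Z(L)=L^2=0$, which
  -- needs no generators.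
  have hd1 : d ≠ 1 := by
    rintro rfl
    have h0 : Module.finrank K (derivedIdeal K L) = 0 := by
      have : Nat.choose 1 2 = 0 := rfl
      omega
    have hbot : ∀ x ∈ derivedIdeal K L, x = 0 := fun x hx => by
      have := Module.finrank_zero_iff.mp h0
      exact congrArg Subtype.val (Subsingleton.elim (⟨x, hx⟩ : derivedIdeal K L) 0)
    have hall (x : L) : x = 0 := by
      refine hbot x ?_
      rw [hL, LieModule.mem_maxTrivSubmodule]
      exact fun y => hbot _ (lie_mem_derivedIdeal y x)
    have : Subsingleton L := ⟨fun x y => (hall x).trans (hall y).symm⟩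
    have h1 := finrank_eq_of_section hqs hq
    rw [Module.finrank_zero_of_subsingleton, hVd] at h1
    omega
  rw [hVd] at hdim
  set c := Module.finrank K (derivedIdeal K L)
  set m := Module.finrank K (SchurMultiplier π)
  set n := Module.finrank K (cyclicMap (commutatorMap s)).ker
  -- The dimension of the kernel of the commutator map; the claims concern $k=1$ and $k=2$.
  obtain ⟨k, hk⟩ : ∃ k, k + c = d.choose 2 := ⟨d.choose 2 - c, by omega⟩
  have hEk : (dependentPairs e (commutatorMap s)).card ≤ k := by omega
  have hnk : 3 * n ≤ k * (d - 2) :=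
    (Nat.mul_le_mul_left 3 hn).trans (htri.trans (Nat.mul_le_mul_right _ hEk))
  have hn0 : k ≤ 2 → n = 0 := fun h => by
    rw [htri0 (hEk.trans h), Finset.card_empty] at hn
    omega
  clear_value c m n
  have hkQ : (k : ℚ) + c = d * (d - 1) / 2 := by
    rw [← Nat.cast_choose_two]; exact_mod_cast hk
  have hdimQ : (m : ℚ) + c + d * (d - 1) * (d - 2) / 6 = d * (d - 1) / 2 + c * d + n := by
    rw [← Nat.cast_choose_two, ← Nat.cast_choose_three_rat]; exact_mod_cast hdim
  have hm : (m : ℚ) = d * (d - 1) * (d + 1) / 3 - k * (d - 1) + n := by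
    have hc : (c : ℚ) = d * (d - 1) / 2 - k := by linarith
    rw [hc] at hdimQ
    linarith
  have hc (j : ℚ) : (c : ℚ) = d * (d - 1) / 2 - j ↔ (k : ℚ) = j := by
    constructor <;> intro h <;> linarith
  rw [hc, hc, hm]
  have hd1Q : (d : ℚ) - 1 ≠ 0 := sub_ne_zero.mpr (by exact_mod_cast hd1)
  obtain hk2 | hk3 : k ≤ 2 ∨ 3 ≤ k := by omega
  · rw [hn0 hk2, Nat.cast_zero]
    have hiff (j : ℚ) : (k : ℚ) = j ↔ ((k : ℚ) - j) * (d - 1) = 0 := by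
      rw [mul_eq_zero, or_iff_left hd1Q, sub_eq_zero]
    refine ⟨(hiff 1).trans ?_, (hiff 2).trans ?_⟩ <;> constructor <;> intro h <;> linarith
  · have hd2 : 2 ≤ d := by
      by_contra! h
      rw [Nat.choose_eq_zero_of_lt h] at hk
      omega
    have hk3Q : (3 : ℚ) ≤ k := by exact_mod_cast hk3
    have hd2Q : (2 : ℚ) ≤ d := by exact_mod_cast hd2
    have hnQ : 3 * (n : ℚ) ≤ k * (d - 2) := by
      rw [← Nat.cast_two, ← Nat.cast_sub hd2]; exact_mod_cast hnk
    -- Since $k\le3(k-2)$, one has $n\le(k-2)(d-2)<(k-2)(d-1)$. So $\dim\mathcal M(L)$ is strictly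
    -- below its value for $k=2$, hence also below that for $k=1$.
    have hlt : (n : ℚ) < (k - 2) * (d - 1) := by nlinarith
    refine ⟨⟨fun h => ?_, fun h => ?_⟩, ⟨fun h => ?_, fun h => ?_⟩⟩ <;> exfalso <;> linarith
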